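/- Let $d\ge 1$ and $L\ge 0$ be integers. Let $\mathbb S^d\subset\mathbb R^{d+1}$ be the unit sphere with Lebesgue surface measure $\mu$ and geodesic distance $\mathrm d(x,y)=\arccos(x\cdot y)$, and let $\Pi_L$ be the space of complex-valued spherical harmonics of degree at most $L$ on $\mathbb S^d$, i.e. the sum over $0\le\ell\le L$ of the spaces of restrictions to $\mathbb S^d$ of homogeneous harmonic polynomials of degree $\ell$ in $d+1$ variables. For $\xi\in\mathbb S^d$ and $0<r<\pi$ let $S_r:=B(\xi,r)=\{x\in\mathbb S^d:\mathrm d(x,\xi)<r\}$, and for a finite set $\mathscr C\subset S_r$ let $$h_{\mathscr C}:=\sup_{x\in S_r}\min_{\zeta\in\mathscr C}\mathrm d(x,\zeta)$$ be its mesh norm in $S_r$ (with $h_\emptyset=\infty$). Then there is a constant $c_0=c_0(d,L)>0$, depending only on $d$ and $L$, such that for all $\xi\in\mathbb S^d$, all $0<r<\pi$ and all finite $\mathscr C\subset S_r$ with $h_{\mathscr C}\le c_0 r$ the following hold. (a) For all $\varphi\in\Pi_L$, $$\sum_{\zeta\in\mathscr C}|\varphi(\zeta)|^2\ \ge\ \mu(S_r)^{-1}\int_{S_r}|\varphi(x)|^2\,d\mu(x).$$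 (b) $\mathscr C$ is unisolvent for $\Pi_L$: if $p\in\Pi_L$ and $p(\zeta)=0$ for all $\zeta\in\mathscr C$, then $p=0$. (c) For every basis $\phi_1,\dots,\phi_N$ of $\Pi_L$, the Gram matrices $G_{\mathscr C}=\big(\sum_{\zeta\in\mathscr C}\overline{\phi_k(\zeta)}\,\phi_j(\zeta)\big)_{k,j}$ and $G_{S_r}=\big(\int_{S_r}\overline{\phi_k}\,\phi_j\,d\mu\big)_{k,j}$ are invertible, and $$\|G_{\mathscr C}^{-1}\|_2\ \le\ \mu(S_r)\,\|G_{S_r}^{-1}\|_2,$$ where $\|\cdot\|_2$ is the matrix norm induced by the Euclidean norm on $\mathbb C^N$. -/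

import Mathlib

open MeasureTheory
open scoped ENNReal

noncomputable section

namespace SphericalCap

/-- The unit sphere `S^d` in `ℝ^{d+1}` with its Euclidean norm. -/
abbrev Sph (d : ℕ) : Type :=
  Metric.sphere (0 : EuclideanSpace ℝ (Fin (d + 1))) 1

/-- Lebesgue surface measure on `S^d` (not normalized). -/
def surfaceMeasure (d : ℕ) : Measure (Sph d) :=
  (volume : Measure (EuclideanSpace ℝ (Fin (d + 1)))).toSphere

/-- Geodesic distance `arccos (x · y)`. -/
def geoDist {d : ℕ} (x y : Sph d) : ℝ :=
  Real.arccos (inner ℝ (x : EuclideanSpace ℝ (Fin (d + 1))) (y : EuclideanSpace ℝ (Fin (d + 1))))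

/-- The (open) spherical cap `B(ξ, r)`. -/
def cap {d : ℕ} (ξ : Sph d) (r : ℝ) : Set (Sph d) :=
  {x | geoDist x ξ < r}

/-- The mesh norm (fill distance) `h_{D,C} = sup_{x ∈ D} min_{ζ ∈ C} d(x, ζ)`, with value in
`[0, ∞]`; it is `∞` when `C` is empty and `D` is not. -/
def meshNorm {d : ℕ} (D : Set (Sph d)) (C : Finset (Sph d)) : ℝ≥0∞ :=
  ⨆ x ∈ D, ⨅ ζ ∈ C, ENNReal.ofReal (geoDist x ζ)

/-- The Laplacian `∑ i, ∂ᵢ²` on complex polynomials in `d + 1` variables. -/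
def polyLaplacian (d : ℕ) :
    MvPolynomial (Fin (d + 1)) ℂ →ₗ[ℂ] MvPolynomial (Fin (d + 1)) ℂ :=
  ∑ i : Fin (d + 1),
    (MvPolynomial.pderiv (R := ℂ) i).toLinearMap ∘ₗ (MvPolynomial.pderiv (R := ℂ) i).toLinearMap

/-- Restriction of a polynomial in `d + 1` variables to a function on the sphere. -/
def restrictSphere (d : ℕ) : MvPolynomial (Fin (d + 1)) ℂ →ₗ[ℂ] (Sph d → ℂ) where
  toFun p x := MvPolynomial.eval (fun i => ((x.1 i : ℝ) : ℂ)) p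
  map_add' p q := by ext x; simp
  map_smul' c p := by ext x; simp [MvPolynomial.smul_eval]

/-- Spherical harmonics of degree exactly `ℓ`: restrictions to `S^d` of the homogeneous harmonic
polynomials of degree `ℓ` in `d + 1` variables. -/
def sphericalHarmonics (d ℓ : ℕ) : Submodule ℂ (Sph d → ℂ) :=
  (MvPolynomial.homogeneousSubmodule (Fin (d + 1)) ℂ ℓ ⊓
    LinearMap.ker (polyLaplacian d)).map (restrictSphere d)

/-- `Π_L`: the sum of the spaces of spherical harmonics of degrees `ℓ ≤ L`. -/
def harmonicsUpTo (d L : ℕ) : Submodule ℂ (Sph d → ℂ) :=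
  ⨆ ℓ ∈ Finset.range (L + 1), sphericalHarmonics d ℓ

/-- A finite set is unisolvent for a space of functions `V` if only the zero function of `V`
vanishes on it. -/
def IsUnisolvent {d : ℕ} (C : Finset (Sph d)) (V : Submodule ℂ (Sph d → ℂ)) : Prop :=
  ∀ p ∈ V, (∀ ζ ∈ C, p ζ = 0) → p = 0

/-- Gram matrix of functions `f j` for the inner product of `ℓ²(C)`. -/
def gramPoints {d n : ℕ} (C : Finset (Sph d)) (f : Fin n → Sph d → ℂ) :
    Matrix (Fin n) (Fin n) ℂ :=
  Matrix.of fun k j => ∑ ζ ∈ C, (starRingEnd ℂ) (f k ζ) * f j ζ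

/-- Gram matrix of functions `f j` for the inner product of `L²(D)`. -/
def gramRegion {d n : ℕ} (D : Set (Sph d)) (f : Fin n → Sph d → ℂ) :
    Matrix (Fin n) (Fin n) ℂ :=
  Matrix.of fun k j => ∫ x in D, (starRingEnd ℂ) (f k x) * f j x ∂(surfaceMeasure d)

/-- The matrix norm induced by the Euclidean norm on `ℂ^n`. -/
def matNorm2 {n : ℕ} (A : Matrix (Fin n) (Fin n) ℂ) : ℝ :=
  ‖Matrix.toEuclideanCLM (n := Fin n) (𝕜 := ℂ) A‖

end SphericalCap

end

open SphericalCap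

namespace SphericalCap

/-! Let `M` be the supremum of `‖φ‖` on the cap. The average of `‖φ‖ ^ 2` is at most `M ^ 2`, so (a)
follows once two distinct points of `C` carry values at least `3/4 * M`, because `2 * (3/4) ^ 2 >
1`.

Such points exist by a scale-invariant Markov inequality (`exists_lipschitz_greatCircle`): along an
arc of length `T` on which `‖φ‖ ≤ M`, moving by `t` changes `φ` by at most `K * (t / T) * M`, with
`K` depending only on `L`. Indeed, in the half-angle variable `u = tan (t / 2)`, `φ` is a polynomial
of degree at most `2 * L` over `(1 + u ^ 2) ^ L`. From a near-maximum point one walks a small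
multiple of `r` towards the centre, which leaves room for a ball inside the cap, and then moves to a
nearby point of `C`. Two walks of different lengths give two points (`exists_sq_le_sum`).

For (b), vanishing on `C` forces `M = 0`, and a harmonic that vanishes on a cap vanishes everywhere
(`eq_zero_of_cap`). For (c), (a) says that the region Gram matrix is at most `μ(S_r)` times the
point Gram matrix as a quadratic form, and inversion reverses this order (`norm_inverse_le`). -/

/-! ### Markov inequality for polynomials on an interval -/

open Polynomial in
/-- A polynomial is Lipschitz at `0` along `[0, 1]`. -/
theorem exists_norm_eval_sub_eval_zero_le (p : ℂ[X]) :
    ∃ K : ℝ, 0 ≤ K ∧ ∀ s : ℝ, 0 ≤ s → s ≤ 1 → ‖p.eval (s : ℂ) - p.eval 0‖ ≤ K * s := by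
  have hc : ContinuousOn (fun s : ℝ => p.divX.eval (s : ℂ)) (Set.Icc 0 1) := by
    fun_prop
  obtain ⟨K, hK⟩ := isCompact_Icc.exists_bound_of_continuousOn hc
  refine ⟨K, (norm_nonneg _).trans (hK 0 (by simp)), fun s h0 h1 => ?_⟩
  have : p.eval (s : ℂ) - p.eval 0 = p.divX.eval (s : ℂ) * s := by
    conv_lhs => rw [← p.divX_mul_X_add]
    simp
  rw [this, norm_mul, Complex.norm_real, Real.norm_of_nonneg h0]
  exact mul_le_mul_of_nonneg_right (hK s ⟨h0, h1⟩) h0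

open Polynomial in
/-- Markov-type inequality at the left end point of `[0, 1]`. -/
theorem exists_markov_unit (n : ℕ) :
    ∃ K : ℝ, 0 ≤ K ∧ ∀ (q : ℂ[X]) (M : ℝ), q.natDegree ≤ n →
      (∀ s : ℝ, 0 ≤ s → s ≤ 1 → ‖q.eval (s : ℂ)‖ ≤ M) →
      ∀ s : ℝ, 0 ≤ s → s ≤ 1 → ‖q.eval (s : ℂ) - q.eval 0‖ ≤ K * s * M := by
  -- Interpolate at `n + 1` nodes of `[0, 1]`: `q` is a combination of fixed basis polynomials with
  -- coefficients bounded by `M`. Dividing by `n + 1` rather than `n` covers `n = 0`.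
  let v : ℕ → ℂ := fun i => (((i : ℝ) / (n + 1) : ℝ) : ℂ)
  have hv : Set.InjOn v (Finset.range (n + 1)) := by
    intro i _ j _ h
    have h' : (i : ℝ) / (n + 1) = (j : ℝ) / (n + 1) := Complex.ofReal_injective h
    have hn : (n : ℝ) + 1 ≠ 0 := by positivity
    field_simp at h'
    exact_mod_cast h'
  choose K hK0 hK using fun i : ℕ =>
    exists_norm_eval_sub_eval_zero_le (Lagrange.basis (Finset.range (n + 1)) v i)
  refine ⟨∑ i ∈ Finset.range (n + 1), K i, Finset.sum_nonneg fun i _ => hK0 i, ?_⟩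
  intro q M hq hM s h0 h1
  have hdeg : q.degree < (Finset.range (n + 1)).card := by
    rw [Finset.card_range]
    exact (degree_le_natDegree).trans_lt (by exact_mod_cast Nat.lt_succ_of_le hq)
  have e : ∀ z : ℂ, q.eval z = ∑ i ∈ Finset.range (n + 1),
      q.eval (v i) * (Lagrange.basis (Finset.range (n + 1)) v i).eval z := by
    intro z
    conv_lhs => rw [Lagrange.eq_interpolate hv hdeg]
    simp [Lagrange.interpolate_apply, eval_finsetSum]
  rw [e s, e 0, ← Finset.sum_sub_distrib, Finset.sum_mul, Finset.sum_mul]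
  refine (norm_sum_le _ _).trans (Finset.sum_le_sum fun i hi => ?_)
  rw [← mul_sub, norm_mul, mul_comm]
  refine mul_le_mul (hK i s h0 h1) (hM _ (by positivity) ?_) (norm_nonneg _)
    (mul_nonneg (hK0 i) h0)
  have : (i : ℝ) < n + 1 := by exact_mod_cast Finset.mem_range.1 hi
  rw [div_le_one (by positivity)]
  exact this.le

open Polynomial in
/-- Markov-type inequality at the left end point of `[0, U]`. -/
theorem exists_markov (n : ℕ) :
    ∃ K : ℝ, 0 ≤ K ∧ ∀ (q : ℂ[X]) (U M : ℝ), 0 < U → q.natDegree ≤ n →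
      (∀ u : ℝ, 0 ≤ u → u ≤ U → ‖q.eval (u : ℂ)‖ ≤ M) →
      ∀ u : ℝ, 0 ≤ u → u ≤ U → ‖q.eval (u : ℂ) - q.eval 0‖ ≤ K * (u / U) * M := by
  obtain ⟨K, hK0, hK⟩ := exists_markov_unit n
  refine ⟨K, hK0, fun q U M hU hq hM u h0 h1 => ?_⟩
  have e : ∀ z : ℂ, (q.comp (C (U : ℂ) * X)).eval z = q.eval (U * z) := by
    intro z; simp
  have hd : (q.comp (C (U : ℂ) * X)).natDegree ≤ n := by
    refine natDegree_comp_le.trans ?_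
    have : (C (U : ℂ) * X).natDegree ≤ 1 := (natDegree_C_mul_le _ _).trans natDegree_X_le
    nlinarith
  have := hK _ M hd (fun s hs0 hs1 => by
    rw [e]
    have := hM (U * s) (by positivity) (by nlinarith)
    push_cast at this
    exact this) (u / U) (by positivity) ((div_le_one hU).2 h1)
  rw [e, e] at this
  have h2 : (U : ℂ) * ((u / U : ℝ) : ℂ) = u := by
    rw [← Complex.ofReal_mul, mul_div_cancel₀ _ hU.ne']
  rwa [h2, mul_zero] at this

/-! ### Spherical harmonics along great circles -/

/-- The point at parameter `t` of the great circle through `x` with direction `v`. -/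
noncomputable def greatCircle {d : ℕ} (x v : Sph d)
    (h : inner ℝ (x : EuclideanSpace ℝ (Fin (d + 1))) (v : EuclideanSpace ℝ (Fin (d + 1))) = 0)
    (t : ℝ) : Sph d :=
  ⟨Real.cos t • (x : EuclideanSpace ℝ (Fin (d + 1))) + Real.sin t • v, by
    have hx : ‖(x : EuclideanSpace ℝ (Fin (d + 1)))‖ = 1 := by simp
    have hv : ‖(v : EuclideanSpace ℝ (Fin (d + 1)))‖ = 1 := by simp
    rw [mem_sphere_zero_iff_norm]
    have := norm_add_sq_eq_norm_sq_add_norm_sq_of_inner_eq_zero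
      (Real.cos t • (x : EuclideanSpace ℝ (Fin (d + 1)))) (Real.sin t • v.1)
      (by rw [real_inner_smul_left, real_inner_smul_right, h]; simp)
    rw [norm_smul, norm_smul, hx, hv] at this
    simp only [Real.norm_eq_abs, mul_one, abs_mul_abs_self] at this
    nlinarith [Real.sin_sq_add_cos_sq t, norm_nonneg
      (Real.cos t • (x : EuclideanSpace ℝ (Fin (d + 1))) + Real.sin t • v.1)]⟩

variable {d : ℕ}

theorem eval_smul_of_isHomogeneous {σ : Type*} {P : MvPolynomial σ ℂ} {n : ℕ}
    (hP : P.IsHomogeneous n) (c : ℂ) (y : σ → ℂ) :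
    MvPolynomial.eval (fun i => c * y i) P = c ^ n * MvPolynomial.eval y P := by
  rw [MvPolynomial.eval_eq, MvPolynomial.eval_eq, Finset.mul_sum]
  refine Finset.sum_congr rfl fun m hm => ?_
  have : ∑ i ∈ m.support, m i = n := by
    have := hP (MvPolynomial.mem_support_iff.1 hm)
    rw [Finsupp.weight_apply, Finsupp.sum] at this
    simpa using this
  simp_rw [mul_pow, Finset.prod_mul_distrib, Finset.prod_pow_eq_pow_sum, this]
  ring

open Polynomial in
/-- In the variable `u = tan (t / 2)` a spherical harmonic of degree at most `L` is, along a great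
circle, a polynomial of degree at most `2 L` divided by `(1 + u²) ^ L`. -/
theorem exists_polynomial_greatCircle {L : ℕ} {φ : Sph d → ℂ} (hφ : φ ∈ harmonicsUpTo d L)
    (x v : Sph d)
    (h : inner ℝ (x : EuclideanSpace ℝ (Fin (d + 1))) (v : EuclideanSpace ℝ (Fin (d + 1))) = 0) :
    ∃ q : ℂ[X], q.natDegree ≤ 2 * L ∧ ∀ t : ℝ, Real.cos (t / 2) ≠ 0 →
      q.eval (Real.tan (t / 2) : ℂ) =
        (1 + (Real.tan (t / 2) : ℂ) ^ 2) ^ L * φ (greatCircle x v h t) := by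
  let S : Submodule ℂ (Sph d → ℂ) :=
    { carrier := {f | ∃ q : ℂ[X], q.natDegree ≤ 2 * L ∧ ∀ t : ℝ, Real.cos (t / 2) ≠ 0 →
        q.eval (Real.tan (t / 2) : ℂ) =
          (1 + (Real.tan (t / 2) : ℂ) ^ 2) ^ L * f (greatCircle x v h t)}
      zero_mem' := ⟨0, by simp, by simp⟩
      add_mem' := by
        rintro f g ⟨p, hp, hp'⟩ ⟨q, hq, hq'⟩
        refine ⟨p + q, (natDegree_add_le _ _).trans (max_le hp hq), fun t ht => ?_⟩
        rw [eval_add, hp' t ht, hq' t ht, Pi.add_apply, mul_add]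
      smul_mem' := by
        rintro c f ⟨p, hp, hp'⟩
        refine ⟨C c * p, (natDegree_C_mul_le _ _).trans hp, fun t ht => ?_⟩
        rw [eval_mul, eval_C, hp' t ht, Pi.smul_apply, smul_eq_mul]
        ring }
  suffices hS : harmonicsUpTo d L ≤ S from hS hφ
  refine iSup₂_le fun ℓ hℓ => ?_
  have hℓL : ℓ ≤ L := Nat.lt_succ_iff.1 (Finset.mem_range.1 hℓ)
  rintro _ ⟨P, ⟨hP, -⟩, rfl⟩
  have hP' : P.IsHomogeneous ℓ := hP
  -- Half-angle formulas: `F i` at `u` is `1 + u ^ 2` times the `i`-th coordinate on the circle.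
  -- Homogeneity of `P` then yields the factor `(1 + u ^ 2) ^ ℓ`, padded below to exponent `L`.
  let F : Fin (d + 1) → ℂ[X] := fun i =>
    C ((x.1 i : ℝ) : ℂ) * (1 - X ^ 2) + C (2 * ((v.1 i : ℝ) : ℂ)) * X
  have hF : ∀ i, (F i).natDegree ≤ 2 := by
    intro i
    simp only [F]
    compute_degree
  refine ⟨(1 + X ^ 2) ^ (L - ℓ) * MvPolynomial.aeval F P, ?_, fun t ht => ?_⟩
  · have h1 : (MvPolynomial.aeval F P).natDegree ≤ ℓ * 2 :=
      MvPolynomial.aeval_natDegree_le P hP'.totalDegree_le F hF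
    have h2 : ((1 + X ^ 2 : ℂ[X]) ^ (L - ℓ)).natDegree ≤ (L - ℓ) * 2 := by
      refine natDegree_pow_le_of_le _ ?_
      compute_degree
    refine natDegree_mul_le.trans ?_
    omega
  · set u : ℝ := Real.tan (t / 2) with hu
    have hsq : (1 + u ^ 2) * Real.cos (t / 2) ^ 2 = 1 := by
      rw [hu, Real.tan_eq_sin_div_cos]
      field_simp
      exact Real.cos_sq_add_sin_sq _
    have hut : u * Real.cos (t / 2) = Real.sin (t / 2) := Real.tan_mul_cos ht
    have hcos : (1 + u ^ 2) * Real.cos t = 1 - u ^ 2 := by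
      have : Real.cos t = 2 * Real.cos (t / 2) ^ 2 - 1 := by
        rw [← Real.cos_two_mul]; ring_nf
      rw [this]; linear_combination 2 * hsq
    have hsin : (1 + u ^ 2) * Real.sin t = 2 * u := by
      have : Real.sin t = 2 * Real.sin (t / 2) * Real.cos (t / 2) := by
        rw [← Real.sin_two_mul]; ring_nf
      rw [this, ← hut]; linear_combination 2 * u * hsq
    have key : eval (u : ℂ) (MvPolynomial.aeval F P) =
        MvPolynomial.eval (fun i => (1 + (u : ℂ) ^ 2) *
          (((greatCircle x v h t).1 i : ℝ) : ℂ)) P := by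
      have hF' : (fun i => (1 + (u : ℂ) ^ 2) * (((greatCircle x v h t).1 i : ℝ) : ℂ)) =
          fun i => eval (u : ℂ) (F i) := by
        funext i
        have e : (1 + u ^ 2) * (greatCircle x v h t).1 i =
            x.1 i * (1 - u ^ 2) + 2 * v.1 i * u := by
          simp only [greatCircle, PiLp.add_apply, PiLp.smul_apply, smul_eq_mul]
          linear_combination x.1 i * hcos + v.1 i * hsin
        have e' := congrArg (fun a : ℝ => (a : ℂ)) e
        push_cast at e'
        simp only [F, eval_add, eval_mul, eval_C, eval_sub, eval_one, eval_pow, eval_X]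
        exact e'
      rw [hF']
      change (Polynomial.aeval (u : ℂ)) _ = _
      rw [MvPolynomial.comp_aeval_apply]
      rfl
    rw [eval_mul, key, eval_smul_of_isHomogeneous hP', ← mul_assoc]
    simp only [eval_pow, eval_add, eval_one, eval_X]
    rw [← pow_add, Nat.sub_add_cancel hℓL]
    rfl

theorem continuous_of_mem_harmonicsUpTo {L : ℕ} {φ : Sph d → ℂ} (hφ : φ ∈ harmonicsUpTo d L) :
    Continuous φ := by
  have : harmonicsUpTo d L ≤ LinearMap.range (restrictSphere d) :=
    iSup₂_le fun ℓ _ => LinearMap.map_le_range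
  obtain ⟨P, rfl⟩ := this hφ
  change Continuous fun x : Sph d => MvPolynomial.eval (fun i => ((x.1 i : ℝ) : ℂ)) P
  refine (MvPolynomial.continuous_eval P).comp ?_
  fun_prop

theorem one_add_pow_sub_one_le (L : ℕ) {a : ℝ} (h0 : 0 ≤ a) (h1 : a ≤ 1) :
    (1 + a) ^ L - 1 ≤ (2 ^ L - 1) * a := by
  induction L with
  | zero => simp
  | succ n ih =>
    have h2 : (1 : ℝ) ≤ 2 ^ n := one_le_pow₀ (by norm_num)
    rw [pow_succ, pow_succ]
    nlinarith [mul_nonneg (mul_nonneg h0 (sub_nonneg.2 h1)) (sub_nonneg.2 h2)]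

theorem tan_le_two_mul {s : ℝ} (h0 : 0 ≤ s) (h1 : s ≤ Real.pi / 4) : Real.tan s ≤ 2 * s := by
  have hs1 : s ≤ 1 := by linarith [Real.pi_lt_four]
  have hc : 1 / 2 ≤ Real.cos s := by
    nlinarith [Real.one_sub_sq_div_two_le_cos (x := s)]
  rw [Real.tan_eq_sin_div_cos, div_le_iff₀ (by linarith)]
  nlinarith [Real.sin_le h0]

@[simp]
theorem greatCircle_zero (x v : Sph d)
    (h : inner ℝ (x : EuclideanSpace ℝ (Fin (d + 1))) (v : EuclideanSpace ℝ (Fin (d + 1))) = 0) :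
    greatCircle x v h 0 = x := by
  ext1
  simp [greatCircle]

/-- Markov-type inequality for spherical harmonics along an arc of a great circle. -/
theorem exists_lipschitz_greatCircle (d L : ℕ) :
    ∃ K : ℝ, 0 < K ∧ ∀ φ ∈ harmonicsUpTo d L, ∀ (x v : Sph d)
      (h : inner ℝ (x : EuclideanSpace ℝ (Fin (d + 1))) (v : EuclideanSpace ℝ (Fin (d + 1))) = 0)
      (T M : ℝ), 0 < T → T ≤ Real.pi / 2 →
      (∀ t : ℝ, 0 ≤ t → t ≤ T → ‖φ (greatCircle x v h t)‖ ≤ M) →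
      ∀ t : ℝ, 0 ≤ t → t ≤ T → ‖φ (greatCircle x v h t) - φ x‖ ≤ K * (t / T) * M := by
  obtain ⟨K, hK0, hK⟩ := exists_markov (2 * L)
  -- `2 ^ L` bounds the weight `(1 + u ^ 2) ^ L`, as `T ≤ π / 2` gives `u ≤ 1`; the `2` compares `u
  -- / U` with `t / T`; the `+ 1` pays for the variation of the weight.
  refine ⟨2 ^ L * 2 * (K + 1), by positivity, fun φ hφ x v h T M hT hT2 hM t ht0 htT => ?_⟩
  obtain ⟨q, hqd, hq⟩ := exists_polynomial_greatCircle hφ x v h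
  have hpi := Real.pi_pos
  have hM0 : 0 ≤ M := (norm_nonneg _).trans (hM 0 le_rfl hT.le)
  have hcos : ∀ s : ℝ, 0 ≤ s → s ≤ T → Real.cos (s / 2) ≠ 0 := fun s h0 h1 =>
    (Real.cos_pos_of_mem_Ioo ⟨by linarith, by linarith⟩).ne'
  have hmono : ∀ s₁ s₂ : ℝ, 0 ≤ s₁ → s₁ ≤ s₂ → s₂ ≤ Real.pi / 2 →
      Real.tan (s₁ / 2) ≤ Real.tan (s₂ / 2) := fun s₁ s₂ h0 h1 h2 =>
    Real.strictMonoOn_tan.monotoneOn ⟨by linarith, by linarith⟩ ⟨by linarith, by linarith⟩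
      (by linarith)
  set U := Real.tan (T / 2) with hU
  set u := Real.tan (t / 2) with hu
  have hUT : T / 2 ≤ U := Real.le_tan (by linarith) (by linarith)
  have hU0 : 0 < U := by linarith
  have hU1 : U ≤ 1 := by
    have := hmono T (Real.pi / 2) hT.le hT2 le_rfl
    rwa [show Real.pi / 2 / 2 = Real.pi / 4 by ring, Real.tan_pi_div_four] at this
  have hu0 : 0 ≤ u := by simpa using hmono 0 t le_rfl ht0 (by linarith)
  have huU : u ≤ U := hmono t T ht0 htT hT2
  have hut : u ≤ t := by
    have := tan_le_two_mul (s := t / 2) (by linarith) (by linarith)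
    linarith
  have huU' : u / U ≤ 2 * (t / T) := by
    rw [div_le_iff₀ hU0, mul_assoc, ← mul_div_right_comm, ← mul_div_assoc, le_div_iff₀ hT]
    nlinarith
  have hnorm : ∀ s : ℝ, ‖(1 + (s : ℂ) ^ 2) ^ L‖ = (1 + s ^ 2) ^ L := by
    intro s
    rw [norm_pow, ← Complex.ofReal_pow, ← Complex.ofReal_one, ← Complex.ofReal_add,
      Complex.norm_real, Real.norm_of_nonneg (by positivity)]
  have hqM : ∀ w : ℝ, 0 ≤ w → w ≤ U → ‖q.eval (w : ℂ)‖ ≤ 2 ^ L * M := by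
    intro w hw0 hwU
    have ha0 : 0 ≤ 2 * Real.arctan w := by
      have := Real.arctan_nonneg.2 hw0
      linarith
    have haT : 2 * Real.arctan w ≤ T := by
      have := Real.arctan_strictMono.monotone hwU
      rw [hU, Real.arctan_tan (by linarith) (by linarith)] at this
      linarith
    have := hq (2 * Real.arctan w) (hcos _ ha0 haT)
    rw [mul_div_cancel_left₀ _ two_ne_zero, Real.tan_arctan] at this
    rw [this, norm_mul, hnorm]
    exact mul_le_mul (pow_le_pow_left₀ (by positivity) (by nlinarith) _) (hM _ ha0 haT)
      (norm_nonneg _) (by positivity)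
  have hmk := hK q U _ hU0 hqd hqM u hu0 huU
  have hq0 : q.eval 0 = φ x := by
    simpa using hq 0 (by simp)
  have hqt := hq t (hcos t ht0 htT)
  rw [← hu] at hqt
  rw [hqt, hq0] at hmk
  have hW : 1 ≤ (1 + u ^ 2) ^ L := one_le_pow₀ (by nlinarith)
  have hW2 : (1 + u ^ 2) ^ L - 1 ≤ 2 ^ L * (u / U) := by
    have h1 := one_add_pow_sub_one_le L (a := u ^ 2) (by positivity) (by nlinarith)
    have h2 : u ^ 2 ≤ u / U := by
      rw [le_div_iff₀ hU0]
      have : u ^ 2 * U ≤ u ^ 2 * 1 := by gcongr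
      nlinarith
    have h3 : (0 : ℝ) < 2 ^ L := by positivity
    nlinarith [sq_nonneg u]
  have hx : ‖φ x‖ ≤ M := by simpa using hM 0 le_rfl hT.le
  set W : ℂ := (1 + (u : ℂ) ^ 2) ^ L with hWdef
  have hWn : ‖W‖ = (1 + u ^ 2) ^ L := hnorm u
  have hW1 : ‖W - 1‖ = (1 + u ^ 2) ^ L - 1 := by
    have : W - 1 = (((1 + u ^ 2) ^ L - 1 : ℝ) : ℂ) := by rw [hWdef]; push_cast; ring
    rw [this, Complex.norm_real, Real.norm_of_nonneg (by linarith)]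
  calc ‖φ (greatCircle x v h t) - φ x‖
      ≤ ‖W‖ * ‖φ (greatCircle x v h t) - φ x‖ :=
        le_mul_of_one_le_left (norm_nonneg _) (hWn ▸ hW)
    _ = ‖(W * φ (greatCircle x v h t) - φ x) - (W - 1) * φ x‖ := by
        rw [← norm_mul]; ring_nf
    _ ≤ K * (u / U) * (2 ^ L * M) + 2 ^ L * (u / U) * M := by
        refine (norm_sub_le _ _).trans (add_le_add hmk ?_)
        rw [norm_mul, hW1]
        exact mul_le_mul hW2 hx (norm_nonneg _) (by positivity)
    _ = 2 ^ L * (K + 1) * (u / U) * M := by ring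
    _ ≤ 2 ^ L * (K + 1) * (2 * (t / T)) * M := by gcongr
    _ = _ := by ring

/-! ### Geodesic distance -/

theorem geoDist_eq_angle (x y : Sph d) :
    geoDist x y = InnerProductGeometry.angle (x : EuclideanSpace ℝ (Fin (d + 1))) y.1 := by
  simp [geoDist, InnerProductGeometry.angle]

theorem geoDist_comm (x y : Sph d) : geoDist x y = geoDist y x := by
  rw [geoDist_eq_angle, geoDist_eq_angle, InnerProductGeometry.angle_comm]

theorem geoDist_nonneg (x y : Sph d) : 0 ≤ geoDist x y := Real.arccos_nonneg _

theorem geoDist_le_pi (x y : Sph d) : geoDist x y ≤ Real.pi := Real.arccos_le_pi _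

theorem geoDist_triangle (x y z : Sph d) : geoDist x z ≤ geoDist x y + geoDist y z := by
  simp only [geoDist_eq_angle]
  exact InnerProductGeometry.angle_le_angle_add_angle _ _ _

theorem geoDist_self (x : Sph d) : geoDist x x = 0 := by
  rw [geoDist_eq_angle, InnerProductGeometry.angle_self]
  exact ne_zero_of_mem_unit_sphere x

theorem cos_geoDist (x y : Sph d) :
    Real.cos (geoDist x y) = inner ℝ (x : EuclideanSpace ℝ (Fin (d + 1))) y.1 := by
  rw [geoDist_eq_angle, InnerProductGeometry.cos_angle]
  simp

theorem geoDist_greatCircle (x v : Sph d)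
    (h : inner ℝ (x : EuclideanSpace ℝ (Fin (d + 1))) (v : EuclideanSpace ℝ (Fin (d + 1))) = 0)
    {s t : ℝ} (hst : |s - t| ≤ Real.pi) :
    geoDist (greatCircle x v h s) (greatCircle x v h t) = |s - t| := by
  have hx : inner ℝ (x : EuclideanSpace ℝ (Fin (d + 1))) x.1 = 1 := by
    rw [real_inner_self_eq_norm_sq]; simp
  have hv : inner ℝ (v : EuclideanSpace ℝ (Fin (d + 1))) v.1 = 1 := by
    rw [real_inner_self_eq_norm_sq]; simp
  rw [geoDist]
  have : inner ℝ (greatCircle x v h s).1 (greatCircle x v h t).1 = Real.cos |s - t| := by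
    simp only [greatCircle, inner_add_left, inner_add_right, real_inner_smul_left,
      real_inner_smul_right, hx, hv, h, real_inner_comm x.1 v.1]
    rw [Real.cos_abs, Real.cos_sub]
    ring
  rw [this, Real.arccos_cos (abs_nonneg _) hst]

theorem exists_orthogonal (hd : 1 ≤ d) (x : Sph d) :
    ∃ v : Sph d,
      inner ℝ (x : EuclideanSpace ℝ (Fin (d + 1))) (v : EuclideanSpace ℝ (Fin (d + 1))) = 0 := by
  have : Fact (Module.finrank ℝ (EuclideanSpace ℝ (Fin (d + 1))) = d + 1) := ⟨by simp⟩
  have hfin := Submodule.finrank_orthogonal_span_singleton (𝕜 := ℝ) (n := d)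
    (ne_zero_of_mem_unit_sphere x)
  have : Nontrivial (ℝ ∙ x.1)ᗮ := Module.nontrivial_of_finrank_pos (R := ℝ) (by omega)
  obtain ⟨w, hw⟩ := exists_ne (0 : (ℝ ∙ x.1)ᗮ)
  have hw' : w.1 ≠ 0 := by simpa using hw
  refine ⟨⟨‖w.1‖⁻¹ • w.1, by simp [norm_smul, hw']⟩, ?_⟩
  rw [real_inner_smul_right, Submodule.mem_orthogonal_singleton_iff_inner_right.1 w.2, mul_zero]

/-- Any two points of the sphere are joined by a great circle, parametrized by arc length. -/
theorem exists_greatCircle (hd : 1 ≤ d) (x y : Sph d) :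
    ∃ (v : Sph d) (h : inner ℝ (x : EuclideanSpace ℝ (Fin (d + 1)))
      (v : EuclideanSpace ℝ (Fin (d + 1))) = 0), greatCircle x v h (geoDist x y) = y := by
  set c := Real.cos (geoDist x y) with hc
  have hcin : inner ℝ x.1 y.1 = c := (cos_geoDist x y).symm
  have hxx : inner ℝ (x : EuclideanSpace ℝ (Fin (d + 1))) x.1 = 1 := by
    rw [real_inner_self_eq_norm_sq]; simp
  have hyy : inner ℝ (y : EuclideanSpace ℝ (Fin (d + 1))) y.1 = 1 := by
    rw [real_inner_self_eq_norm_sq]; simp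
  set w := y.1 - c • x.1 with hw
  have hxw : inner ℝ x.1 w = 0 := by
    rw [hw, inner_sub_right, real_inner_smul_right, hxx, hcin]; ring
  have hs0 : 0 ≤ Real.sin (geoDist x y) :=
    Real.sin_nonneg_of_nonneg_of_le_pi (geoDist_nonneg _ _) (geoDist_le_pi _ _)
  have hwn : ‖w‖ = Real.sin (geoDist x y) := by
    have h1 : ‖w‖ ^ 2 = 1 - c ^ 2 := by
      rw [← real_inner_self_eq_norm_sq]
      conv_lhs => rw [hw]
      rw [inner_sub_left, inner_sub_right, inner_sub_right, real_inner_smul_left,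
        real_inner_smul_right, real_inner_smul_left, real_inner_smul_right, hxx, hyy,
        real_inner_comm x.1 y.1, hcin]
      ring
    have h2 := Real.sin_sq_add_cos_sq (geoDist x y)
    rw [← hc] at h2
    rw [← abs_of_nonneg (norm_nonneg w), ← abs_of_nonneg hs0, ← sq_eq_sq_iff_abs_eq_abs]
    linarith
  -- Here `y = ± x`, so the direction is not determined and any unit vector orthogonal to `x`
  -- serves.
  by_cases h0 : w = 0
  · obtain ⟨v, hv⟩ := exists_orthogonal hd x
    refine ⟨v, hv, ?_⟩
    ext1
    rw [h0, norm_zero] at hwn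
    simp only [greatCircle]
    rw [← hwn, zero_smul, add_zero, ← hc]
    exact (sub_eq_zero.1 (hw.symm.trans h0)).symm
  · have hn : ‖w‖ ≠ 0 := norm_ne_zero_iff.2 h0
    refine ⟨⟨‖w‖⁻¹ • w, by simp [norm_smul, hn]⟩, ?_, ?_⟩
    · rw [real_inner_smul_right, hxw, mul_zero]
    · ext1
      simp only [greatCircle]
      rw [← hwn, ← hc, smul_smul, mul_inv_cancel₀ hn, one_smul, hw]
      abel

theorem continuous_geoDist (ξ : Sph d) : Continuous fun x => geoDist x ξ := by
  unfold geoDist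
  fun_prop

theorem isOpen_cap (ξ : Sph d) (r : ℝ) : IsOpen (cap ξ r) :=
  isOpen_lt (continuous_geoDist ξ) continuous_const

/-! ### Two sampling points with large values -/

theorem exists_geoDist_lt_of_meshNorm_le {D : Set (Sph d)} {C : Finset (Sph d)} {a b : ℝ}
    (hab : a < b) (hb : 0 < b) (hC : meshNorm D C ≤ ENNReal.ofReal a) {x : Sph d} (hx : x ∈ D) :
    ∃ ζ ∈ C, geoDist x ζ < b := by
  have h1 : ⨅ ζ ∈ C, ENNReal.ofReal (geoDist x ζ) < ENNReal.ofReal b :=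
    ((le_iSup₂ (f := fun x (_ : x ∈ D) => ⨅ ζ ∈ C, ENNReal.ofReal (geoDist x ζ)) x hx).trans
      hC).trans_lt ((ENNReal.ofReal_lt_ofReal_iff hb).2 hab)
  simp only [iInf_lt_iff] at h1
  obtain ⟨ζ, hζ, h⟩ := h1
  exact ⟨ζ, hζ, (ENNReal.ofReal_lt_ofReal_iff hb).1 h⟩

/-- Moving from a point of a cap towards the centre, one sits in ever larger balls inside it. -/
theorem mem_cap_of_geoDist_greatCircle_le {ξ x v : Sph d} {r t : ℝ} (hr : r < Real.pi)
    (h : inner ℝ (x : EuclideanSpace ℝ (Fin (d + 1)))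
      (v : EuclideanSpace ℝ (Fin (d + 1))) = 0)
    (hξ : greatCircle x v h (geoDist x ξ) = ξ) (hx : x ∈ cap ξ r) (ht0 : 0 ≤ t)
    (ht : t < r / 2) {y : Sph d} (hy : geoDist (greatCircle x v h t) y ≤ t) : y ∈ cap ξ r := by
  have hx' : geoDist x ξ < r := hx
  have h0 := geoDist_nonneg x ξ
  -- The walk may overshoot the centre; `t < r / 2` makes this harmless.
  have h1 : |t - geoDist x ξ| < r - t := abs_lt.2 ⟨by linarith, by linarith⟩
  have h2 := geoDist_greatCircle x v h (s := t) (t := geoDist x ξ) (by linarith)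
  rw [hξ] at h2
  have h3 := geoDist_triangle y (greatCircle x v h t) ξ
  rw [geoDist_comm y (greatCircle x v h t)] at h3
  change geoDist y ξ < r
  linarith

/-- Each walk loses at most `8 * K * δ * M`: `6 * K * δ * M` from the near-maximum to the centre of
a ball in the cap, and `2 * K * δ * M` from there to a point of `C`. -/
theorem exists_sq_le_sum (hd : 1 ≤ d) (L : ℕ) :
    ∃ c₀ : ℝ, 0 < c₀ ∧ ∀ (ξ : Sph d) (r : ℝ), 0 < r → r < Real.pi → ∀ C : Finset (Sph d),
      meshNorm (cap ξ r) C ≤ ENNReal.ofReal (c₀ * r) →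
      ∀ φ ∈ harmonicsUpTo d L, ∀ M : ℝ, 0 < M → (∀ x ∈ cap ξ r, ‖φ x‖ ≤ M) →
      (∃ x ∈ cap ξ r, 19 / 20 * M ≤ ‖φ x‖) → M ^ 2 ≤ ∑ ζ ∈ C, ‖φ ζ‖ ^ 2 := by
  obtain ⟨K, hK0, hK⟩ := exists_lipschitz_greatCircle d L
  -- This gives `8 * K * δ ≤ 1/5 = 19/20 - 3/4` for the values, and `δ ≤ 1/8` for the geometry.
  obtain ⟨δ, hδ⟩ : ∃ δ : ℝ, δ = 1 / (40 * K + 8) := ⟨_, rfl⟩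
  have hδ0 : 0 < δ := by rw [hδ]; positivity
  have hKδ : 40 * (K * δ) + 8 * δ = 1 := by rw [hδ]; field_simp
  have hKδ0 : 0 < K * δ := by positivity
  refine ⟨δ ^ 2, by positivity, ?_⟩
  rintro ξ r hr0 hrpi C hC φ hφ M hM0 hM ⟨x, hx, hxM⟩
  obtain ⟨v, hv, hξ⟩ := exists_greatCircle hd x ξ
  have hδr : 0 < δ * r := by positivity
  have near : ∀ t : ℝ, δ * r ≤ t → t ≤ 2 * (δ * r) →
      ∃ ζ ∈ C, geoDist (greatCircle x v hv t) ζ < 2 * (δ ^ 2 * r) ∧ 3 / 4 * M ≤ ‖φ ζ‖ := by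
    intro t ht1 ht2
    have ht0 : 0 < t := by linarith
    have htr : t < r / 2 := by nlinarith
    have hin : ∀ y, geoDist (greatCircle x v hv t) y ≤ t → y ∈ cap ξ r := fun y hy =>
      mem_cap_of_geoDist_greatCircle_le hrpi hv hξ hx ht0.le htr hy
    obtain ⟨ζ, hζC, hζ⟩ := exists_geoDist_lt_of_meshNorm_le (b := 2 * (δ ^ 2 * r))
      (by nlinarith) (by positivity) hC (hin _ ((geoDist_self _).trans_le ht0.le))
    refine ⟨ζ, hζC, hζ, ?_⟩
    set p := greatCircle x v hv t with hp
    have hζt : geoDist p ζ ≤ δ * r := by nlinarith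
    have e1 : ‖φ p - φ x‖ ≤ K * (t / (r / 3)) * M := by
      refine hK φ hφ x v hv (r / 3) M (by positivity) (by linarith) (fun s hs0 hs1 => ?_) t ht0.le
        (by nlinarith)
      exact hM _ (mem_cap_of_geoDist_greatCircle_le hrpi hv hξ hx hs0 (by linarith)
        ((geoDist_self _).trans_le hs0))
    have e2 : ‖φ ζ - φ p‖ ≤ K * (geoDist p ζ / (δ * r)) * M := by
      obtain ⟨w, hw, hζw⟩ := exists_greatCircle hd p ζ
      have := hK φ hφ p w hw (δ * r) M hδr (by nlinarith) (fun s hs0 hs1 => ?_) (geoDist p ζ)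
        (geoDist_nonneg _ _) hζt
      · rwa [hζw] at this
      · refine hM _ (hin _ ?_)
        have h3 := geoDist_greatCircle p w hw (s := 0) (t := s)
          (by rw [zero_sub, abs_neg, abs_of_nonneg hs0]; nlinarith)
        rw [greatCircle_zero, zero_sub, abs_neg, abs_of_nonneg hs0] at h3
        linarith
    have f1 : K * (t / (r / 3)) ≤ 6 * (K * δ) := by
      have : t / (r / 3) ≤ 6 * δ := by rw [div_le_iff₀ (by positivity)]; linarith
      nlinarith
    have f2 : K * (geoDist p ζ / (δ * r)) ≤ 2 * (K * δ) := by
      have : geoDist p ζ / (δ * r) ≤ 2 * δ := by rw [div_le_iff₀ hδr]; nlinarith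
      nlinarith
    have g1 : ‖φ x‖ ≤ ‖φ ζ‖ + ‖φ ζ - φ p‖ + ‖φ p - φ x‖ := by
      have := norm_sub_le (φ ζ - (φ ζ - φ p)) (φ p - φ x)
      have h2 := norm_sub_le (φ ζ) (φ ζ - φ p)
      rw [show φ ζ - (φ ζ - φ p) - (φ p - φ x) = φ x by ring] at this
      linarith
    have g2 : K * (t / (r / 3)) * M ≤ 6 * (K * δ) * M := mul_le_mul_of_nonneg_right f1 hM0.le
    have g3 : K * (geoDist p ζ / (δ * r)) * M ≤ 2 * (K * δ) * M :=
      mul_le_mul_of_nonneg_right f2 hM0.le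
    nlinarith
  obtain ⟨ζ₁, hζ₁, hd₁, hφ₁⟩ := near (δ * r) le_rfl (by linarith)
  obtain ⟨ζ₂, hζ₂, hd₂, hφ₂⟩ := near (2 * (δ * r)) (by linarith) le_rfl
  -- The ball centres are `δ * r` apart, while a common point would put them within `4 * δ ^ 2 * r <
  -- δ * r`.
  have hne : ζ₁ ≠ ζ₂ := by
    rintro rfl
    have h1 := geoDist_triangle (greatCircle x v hv (δ * r)) ζ₁
      (greatCircle x v hv (2 * (δ * r)))
    have habs : |δ * r - 2 * (δ * r)| = δ * r := by
      rw [show δ * r - 2 * (δ * r) = -(δ * r) by ring, abs_neg, abs_of_pos hδr]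
    rw [geoDist_greatCircle x v hv (by rw [habs]; nlinarith), habs, geoDist_comm ζ₁] at h1
    nlinarith
  classical
  calc M ^ 2 ≤ ‖φ ζ₁‖ ^ 2 + ‖φ ζ₂‖ ^ 2 := by nlinarith
    _ = ∑ ζ ∈ ({ζ₁, ζ₂} : Finset (Sph d)), ‖φ ζ‖ ^ 2 :=
        (Finset.sum_pair (f := fun ζ => ‖φ ζ‖ ^ 2) hne).symm
    _ ≤ ∑ ζ ∈ C, ‖φ ζ‖ ^ 2 := by
      refine Finset.sum_le_sum_of_subset_of_nonneg ?_ fun _ _ _ => by positivity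
      intro z hz
      rcases Finset.mem_insert.1 hz with rfl | hz
      · exact hζ₁
      · rwa [Finset.mem_singleton.1 hz]

/-- On each great circle through `ξ` the half-angle polynomial has infinitely many roots, so it is
zero. The parameter `u` misses only the antipode of `ξ`. -/
theorem eq_zero_of_cap (hd : 1 ≤ d) {L : ℕ} {φ : Sph d → ℂ} (hφ : φ ∈ harmonicsUpTo d L)
    {ξ : Sph d} {r : ℝ} (hr : 0 < r) (h0 : ∀ x ∈ cap ξ r, φ x = 0) : φ = 0 := by
  have aux : ∀ (ξ : Sph d) (r : ℝ), 0 < r → (∀ x ∈ cap ξ r, φ x = 0) →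
      ∀ y, geoDist ξ y < Real.pi → φ y = 0 := by
    intro ξ r hr h0 y hy
    obtain ⟨v, hv, hyv⟩ := exists_greatCircle hd ξ y
    obtain ⟨q, -, hq⟩ := exists_polynomial_greatCircle hφ ξ v hv
    have hpi := Real.pi_pos
    have hcos : ∀ t : ℝ, 0 ≤ t → t < Real.pi → Real.cos (t / 2) ≠ 0 := fun t h0 h1 =>
      (Real.cos_pos_of_mem_Ioo ⟨by linarith, by linarith⟩).ne'
    have hq0 : q = 0 := by
      refine Polynomial.eq_zero_of_infinite_isRoot q ?_
      have hinf : (Set.Ioo 0 (min r Real.pi)).Infinite := Set.Ioo_infinite (lt_min hr hpi)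
      refine (hinf.image (f := fun t : ℝ => (Real.tan (t / 2) : ℂ)) ?_).mono ?_
      · intro s hs t ht hst
        have hst' : Real.tan (s / 2) = Real.tan (t / 2) := Complex.ofReal_injective hst
        have hs2 := hs.2.trans_le (min_le_right _ _)
        have ht2 := ht.2.trans_le (min_le_right _ _)
        have := Real.injOn_tan ⟨by linarith [hs.1], by linarith⟩
          ⟨by linarith [ht.1], by linarith⟩ hst'
        linarith
      · rintro _ ⟨t, ht, rfl⟩
        have ht2 := ht.2.trans_le (min_le_right _ _)
        have ht3 := ht.2.trans_le (min_le_left _ _)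
        change q.eval _ = 0
        rw [hq t (hcos t ht.1.le ht2), h0, mul_zero]
        change geoDist _ ξ < r
        have h3 := geoDist_greatCircle ξ v hv (s := 0) (t := t)
          (by rw [zero_sub, abs_neg, abs_of_nonneg ht.1.le]; exact ht2.le)
        rw [greatCircle_zero, zero_sub, abs_neg, abs_of_nonneg ht.1.le] at h3
        rwa [geoDist_comm, h3]
    have := hq (geoDist ξ y) (hcos _ (geoDist_nonneg _ _) hy)
    rw [hq0, Polynomial.eval_zero, hyv, eq_comm, mul_eq_zero] at this
    refine this.resolve_left (pow_ne_zero _ ?_)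
    rw [← Complex.ofReal_pow, ← Complex.ofReal_one, ← Complex.ofReal_add, Complex.ofReal_ne_zero]
    positivity
  funext y
  by_cases hy : geoDist ξ y < Real.pi
  · exact aux ξ r hr h0 y hy
  obtain ⟨v, hv⟩ := exists_orthogonal hd ξ
  have hpi := Real.pi_pos
  have hξv : geoDist ξ v = Real.pi / 2 := by rw [geoDist, hv, Real.arccos_zero]
  have hyξ : y.1 = -ξ.1 := by
    have h1 : Real.cos (geoDist ξ y) = -1 := by
      rw [le_antisymm (geoDist_le_pi ξ y) (not_lt.1 hy), Real.cos_pi]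
    rw [cos_geoDist] at h1
    have := (inner_eq_neg_one_iff_of_norm_eq_one (x := ξ.1) (y := y.1) (by simp) (by simp)).1 h1
    rw [this, neg_neg]
  -- The antipode is reached from the hemisphere around `v ⟂ ξ`, where `φ` is already known to
  -- vanish.
  refine aux v (Real.pi / 2) (by positivity) (fun x hx => aux ξ r hr h0 x ?_) y ?_
  · have h1 := geoDist_triangle ξ v x
    have h2 : geoDist x v < Real.pi / 2 := hx
    rw [geoDist_comm x v] at h2
    linarith
  · rw [geoDist, hyξ, inner_neg_right, real_inner_comm, hv]
    simp [hpi]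

/-! ### Supremum, average and integral over a cap -/

instance : IsFiniteMeasure (surfaceMeasure d) := by
  unfold surfaceMeasure; infer_instance

instance : (surfaceMeasure d).IsOpenPosMeasure := by
  unfold surfaceMeasure; infer_instance

theorem self_mem_cap (ξ : Sph d) {r : ℝ} (hr : 0 < r) : ξ ∈ cap ξ r :=
  (geoDist_self ξ).trans_lt hr

theorem measureReal_cap_pos (ξ : Sph d) {r : ℝ} (hr : 0 < r) :
    0 < (surfaceMeasure d).real (cap ξ r) :=
  ENNReal.toReal_pos ((isOpen_cap ξ r).measure_pos _ ⟨ξ, self_mem_cap ξ hr⟩).ne'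
    (measure_ne_top _ _)

/-- The supremum of `‖φ‖` over a cap, together with points that nearly attain it. -/
theorem exists_sup_norm {φ : Sph d → ℂ} (hφ : Continuous φ) (ξ : Sph d) {r : ℝ} (hr : 0 < r) :
    ∃ M : ℝ, 0 ≤ M ∧ (∀ x ∈ cap ξ r, ‖φ x‖ ≤ M) ∧
      (0 < M → ∃ x ∈ cap ξ r, 19 / 20 * M ≤ ‖φ x‖) := by
  obtain ⟨B, hB⟩ := isCompact_univ.exists_bound_of_continuousOn hφ.continuousOn
  have hbdd : BddAbove ((fun x => ‖φ x‖) '' cap ξ r) :=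
    ⟨B, by rintro _ ⟨x, -, rfl⟩; exact hB x trivial⟩
  have hle : ∀ x ∈ cap ξ r, ‖φ x‖ ≤ sSup ((fun x => ‖φ x‖) '' cap ξ r) := fun x hx =>
    le_csSup hbdd ⟨x, hx, rfl⟩
  refine ⟨sSup ((fun x => ‖φ x‖) '' cap ξ r),
    (norm_nonneg _).trans (hle ξ (self_mem_cap ξ hr)), hle, fun hM => ?_⟩
  obtain ⟨_, ⟨x, hx, rfl⟩, h⟩ := exists_lt_of_lt_csSup
    (⟨_, ξ, self_mem_cap ξ hr, rfl⟩ : ((fun x => ‖φ x‖) '' cap ξ r).Nonempty)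
    (show 19 / 20 * sSup ((fun x => ‖φ x‖) '' cap ξ r) < _ by linarith)
  exact ⟨x, hx, h.le⟩

theorem average_le_sq {φ : Sph d → ℂ} {ξ : Sph d} {r M : ℝ} (hr : 0 < r)
    (hM : ∀ x ∈ cap ξ r, ‖φ x‖ ≤ M) :
    ((surfaceMeasure d).real (cap ξ r))⁻¹ *
      ∫ x in cap ξ r, ‖φ x‖ ^ 2 ∂(surfaceMeasure d) ≤ M ^ 2 := by
  have hμ := measureReal_cap_pos ξ hr
  have h := norm_setIntegral_le_of_norm_le_const (μ := surfaceMeasure d) (s := cap ξ r)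
    (f := fun x => ‖φ x‖ ^ 2) (C := M ^ 2) (measure_lt_top _ _) (fun x hx => by
      rw [norm_pow, norm_norm]
      exact pow_le_pow_left₀ (norm_nonneg _) (hM x hx) 2)
  rw [inv_mul_le_iff₀ hμ, mul_comm]
  exact (Real.le_norm_self _).trans h

theorem eq_zero_of_setIntegral_eq_zero {φ : Sph d → ℂ} (hφ : Continuous φ) {ξ : Sph d} {r : ℝ}
    (h : ∫ x in cap ξ r, ‖φ x‖ ^ 2 ∂(surfaceMeasure d) = 0) : ∀ x ∈ cap ξ r, φ x = 0 := by
  have hc : Continuous fun x => ‖φ x‖ ^ 2 := by fun_prop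
  have hint : Integrable (fun x => ‖φ x‖ ^ 2) ((surfaceMeasure d).restrict (cap ξ r)) :=
    (hc.integrable_of_hasCompactSupport (HasCompactSupport.of_compactSpace _)).restrict
  rw [integral_eq_zero_iff_of_nonneg (fun x => by positivity) hint] at h
  have := Measure.eqOn_open_of_ae_eq h (isOpen_cap ξ r) hc.continuousOn continuousOn_const
  intro x hx
  simpa using this hx

/-! ### Gram matrices -/

/-- Loewner monotonicity of the norm of the inverse. -/
theorem norm_inverse_le {E : Type*} [NormedAddCommGroup E] [InnerProductSpace ℂ E]
    {A A' B B' : E →L[ℂ] E} {m : ℝ} (hm : 0 < m) (hA : A * A' = 1) (hB : B * B' = 1)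
    (hsymm : ∀ x y, inner ℂ (A x) y = inner ℂ x (A y))
    (hpos : ∀ x, 0 ≤ (inner ℂ x (A x)).re)
    (hle : ∀ x, (inner ℂ x (A x)).re ≤ m * (inner ℂ x (B x)).re) :
    ‖B'‖ ≤ m * ‖A'‖ := by
  have hAA : ∀ x, A (A' x) = x := fun x => DFunLike.congr_fun hA x
  have hBB : ∀ x, B (B' x) = x := fun x => DFunLike.congr_fun hB x
  have key : ∀ x, ‖x‖ ^ 2 ≤ ‖A'‖ * (inner ℂ x (A x)).re := by
    intro x
    rcases (norm_nonneg A').eq_or_lt with h0 | h0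
    · have : A' = 0 := norm_eq_zero.1 h0.symm
      have hx : x = 0 := by rw [← hAA x, this]; simp
      simp [hx]
    have h1 : (inner ℂ x (A' x)).re ≤ ‖A'‖ * ‖x‖ ^ 2 := by
      refine (Complex.re_le_norm _).trans ((norm_inner_le_norm _ _).trans ?_)
      nlinarith [A'.le_opNorm x, norm_nonneg x]
    have hxx : (inner ℂ x x : ℂ).re = ‖x‖ ^ 2 := inner_self_eq_norm_sq (𝕜 := ℂ) x
    -- With `a = ‖A'‖`, positivity at `a x - A' x` reads `0 ≤ a² ⟨x, A x⟩ - 2 a ‖x‖² + ⟨x, A' x⟩`.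
    -- The last term is at most `a ‖x‖²`, which gives `A ≥ 1 / a` without spectral theory.
    have h2 := hpos (((‖A'‖ : ℝ) : ℂ) • x - A' x)
    have h3 : (inner ℂ (((‖A'‖ : ℝ) : ℂ) • x - A' x) (A (((‖A'‖ : ℝ) : ℂ) • x - A' x))).re =
        ‖A'‖ ^ 2 * (inner ℂ x (A x)).re - 2 * ‖A'‖ * ‖x‖ ^ 2 + (inner ℂ x (A' x)).re := by
      have e1 : inner ℂ (A' x) (A x) = inner ℂ x x := by rw [← hsymm, hAA]
      have e2 : (inner ℂ (A' x) x : ℂ).re = (inner ℂ x (A' x)).re := inner_re_symm (𝕜 := ℂ) _ _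
      rw [map_sub, map_smul, hAA, inner_sub_left, inner_sub_right, inner_sub_right,
        inner_smul_left, inner_smul_right, inner_smul_left, inner_smul_right, e1,
        Complex.conj_ofReal]
      simp only [Complex.sub_re, Complex.re_ofReal_mul, hxx, e2]
      ring
    rw [h3] at h2
    nlinarith
  refine ContinuousLinearMap.opNorm_le_bound _ (by positivity) fun y => ?_
  rcases (norm_nonneg (B' y)).eq_or_lt with h0 | h0
  · rw [← h0]; positivity
  have h1 := key (B' y)
  have h2 := hle (B' y)
  rw [hBB] at h2
  have h3 : (inner ℂ (B' y) y).re ≤ ‖B' y‖ * ‖y‖ :=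
    (Complex.re_le_norm _).trans (norm_inner_le_norm _ _)
  have h4 : ‖B' y‖ * ‖B' y‖ ≤ ‖B' y‖ * (m * ‖A'‖ * ‖y‖) :=
    calc ‖B' y‖ * ‖B' y‖ = ‖B' y‖ ^ 2 := (sq _).symm
      _ ≤ ‖A'‖ * (m * (‖B' y‖ * ‖y‖)) :=
        h1.trans (mul_le_mul_of_nonneg_left (h2.trans (by gcongr)) (norm_nonneg _))
      _ = _ := by ring
  exact le_of_mul_le_mul_left h4 h0

open Matrix in
theorem star_dotProduct_gram {n : ℕ} (g : Fin n → ℂ) (c : Fin n → ℂ) :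
    ∑ k, star (c k) * ∑ j, (starRingEnd ℂ) (g k) * g j * c j =
      ((‖∑ j, c j * g j‖ ^ 2 : ℝ) : ℂ) := by
  rw [Complex.ofReal_pow, ← Complex.conj_mul', map_sum, Finset.sum_mul]
  refine Finset.sum_congr rfl fun k _ => ?_
  rw [Finset.mul_sum, Finset.mul_sum]
  refine Finset.sum_congr rfl fun j _ => ?_
  rw [map_mul, ← starRingEnd_apply]
  ring

open Matrix in
theorem star_dotProduct_gramPoints {n : ℕ} (C : Finset (Sph d)) (f : Fin n → Sph d → ℂ)
    (c : Fin n → ℂ) :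
    star c ⬝ᵥ gramPoints C f *ᵥ c = ((∑ ζ ∈ C, ‖(∑ j, c j • f j) ζ‖ ^ 2 : ℝ) : ℂ) := by
  rw [Complex.ofReal_sum]
  simp only [Finset.sum_apply, Pi.smul_apply, smul_eq_mul]
  simp_rw [← star_dotProduct_gram]
  simp only [dotProduct, mulVec, gramPoints, Matrix.of_apply, Pi.star_apply]
  rw [Finset.sum_comm]
  refine Finset.sum_congr rfl fun k _ => ?_
  rw [← Finset.mul_sum]
  simp_rw [Finset.sum_mul]
  rw [Finset.sum_comm]

open Matrix in
theorem star_dotProduct_gramRegion {n : ℕ} (D : Set (Sph d)) {f : Fin n → Sph d → ℂ}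
    (hf : ∀ j, Continuous (f j)) (c : Fin n → ℂ) :
    star c ⬝ᵥ gramRegion D f *ᵥ c =
      ((∫ x in D, ‖(∑ j, c j • f j) x‖ ^ 2 ∂(surfaceMeasure d) : ℝ) : ℂ) := by
  have hint : ∀ g : Sph d → ℂ, Continuous g → Integrable g ((surfaceMeasure d).restrict D) :=
    fun g hg =>
      (hg.integrable_of_hasCompactSupport (HasCompactSupport.of_compactSpace _)).restrict
  rw [← integral_complex_ofReal]
  simp only [Finset.sum_apply, Pi.smul_apply, smul_eq_mul]
  simp_rw [← star_dotProduct_gram]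
  rw [integral_finsetSum _ fun k _ => hint _ (by fun_prop)]
  simp only [dotProduct, mulVec, gramRegion, Matrix.of_apply, Pi.star_apply]
  refine Finset.sum_congr rfl fun k _ => ?_
  rw [integral_const_mul, integral_finsetSum _ fun k _ => hint _ (by fun_prop)]
  simp_rw [integral_mul_const]

theorem isHermitian_gramRegion {n : ℕ} (D : Set (Sph d)) (f : Fin n → Sph d → ℂ) :
    (gramRegion D f).IsHermitian := by
  ext k j
  simp only [gramRegion, Matrix.conjTranspose_apply, Matrix.of_apply]
  rw [← starRingEnd_apply, ← integral_conj]
  simp [mul_comm]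

open Matrix in
theorem isUnit_of_quadratic_form {n : ℕ} {G : Matrix (Fin n) (Fin n) ℂ}
    (h : ∀ c, star c ⬝ᵥ G *ᵥ c = 0 → c = 0) : IsUnit G := by
  rw [← mulVec_injective_iff_isUnit]
  refine (injective_iff_map_eq_zero G.mulVecLin).2 fun c hc => h c ?_
  rw [mulVecLin_apply] at hc
  rw [hc, dotProduct_zero]

open Matrix in
theorem inner_toEuclideanCLM_eq {n : ℕ} (G : Matrix (Fin n) (Fin n) ℂ)
    (x : EuclideanSpace ℂ (Fin n)) :
    inner ℂ x (toEuclideanCLM (n := Fin n) (𝕜 := ℂ) G x) =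
      star (WithLp.ofLp x) ⬝ᵥ G *ᵥ (WithLp.ofLp x) := by
  rw [EuclideanSpace.inner_eq_star_dotProduct, ofLp_toEuclideanCLM, dotProduct_comm]

open Matrix in
theorem matNorm2_inv_le {n : ℕ} {A B : Matrix (Fin n) (Fin n) ℂ} {m : ℝ} (hm : 0 < m)
    (hA : IsUnit A) (hB : IsUnit B) (hH : A.IsHermitian)
    (hpos : ∀ c : Fin n → ℂ, 0 ≤ (star c ⬝ᵥ A *ᵥ c).re)
    (hle : ∀ c : Fin n → ℂ, (star c ⬝ᵥ A *ᵥ c).re ≤ m * (star c ⬝ᵥ B *ᵥ c).re) :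
    matNorm2 B⁻¹ ≤ m * matNorm2 A⁻¹ := by
  have hinv : ∀ G : Matrix (Fin n) (Fin n) ℂ, IsUnit G →
      toEuclideanCLM (n := Fin n) (𝕜 := ℂ) G * toEuclideanCLM (n := Fin n) (𝕜 := ℂ) G⁻¹ = 1 := by
    intro G hG
    rw [← map_mul, Matrix.mul_nonsing_inv _ ((Matrix.isUnit_iff_isUnit_det _).1 hG), map_one]
  refine norm_inverse_le hm (hinv A hA) (hinv B hB) (fun x y => ?_) (fun x => ?_) fun x => ?_
  · have hs : star (toEuclideanCLM (n := Fin n) (𝕜 := ℂ) A) =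
        toEuclideanCLM (n := Fin n) (𝕜 := ℂ) A := by
      rw [← map_star, Matrix.star_eq_conjTranspose, hH.eq]
    conv_rhs => rw [← hs, ContinuousLinearMap.star_eq_adjoint]
    rw [ContinuousLinearMap.adjoint_inner_right]
  · rw [inner_toEuclideanCLM_eq]; exact hpos _
  · rw [inner_toEuclideanCLM_eq, inner_toEuclideanCLM_eq]; exact hle _

end SphericalCap

/-! ### Assembly of (a), (b) and (c) -/

theorem lemma6p2 (d : ℕ) (hd : 1 ≤ d) (L : ℕ) :
    ∃ c₀ : ℝ, 0 < c₀ ∧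
      ∀ (ξ : Sph d) (r : ℝ), 0 < r → r < Real.pi →
      ∀ C : Finset (Sph d), (C : Set (Sph d)) ⊆ cap ξ r →
      meshNorm (cap ξ r) C ≤ ENNReal.ofReal (c₀ * r) →
        (∀ φ ∈ harmonicsUpTo d L,
          ((surfaceMeasure d).real (cap ξ r))⁻¹ *
              ∫ x in cap ξ r, ‖φ x‖ ^ 2 ∂(surfaceMeasure d)
            ≤ ∑ ζ ∈ C, ‖φ ζ‖ ^ 2) ∧
        IsUnisolvent C (harmonicsUpTo d L) ∧
        (∀ (n : ℕ) (b : Module.Basis (Fin n) ℂ (harmonicsUpTo d L)),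
          IsUnit (gramPoints C (fun j => (b j : Sph d → ℂ))) ∧
          IsUnit (gramRegion (cap ξ r) (fun j => (b j : Sph d → ℂ))) ∧
          matNorm2 (gramPoints C (fun j => (b j : Sph d → ℂ)))⁻¹ ≤
            (surfaceMeasure d).real (cap ξ r) *
              matNorm2 (gramRegion (cap ξ r) (fun j => (b j : Sph d → ℂ)))⁻¹) := by
  obtain ⟨c₀, hc₀, H⟩ := exists_sq_le_sum hd L
  refine ⟨c₀, hc₀, fun ξ r hr hrpi C _ hC => ?_⟩
  have hμ := measureReal_cap_pos ξ hr
  have hsup : ∀ φ ∈ harmonicsUpTo d L, ∃ M : ℝ, 0 ≤ M ∧ (∀ x ∈ cap ξ r, ‖φ x‖ ≤ M) ∧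
      M ^ 2 ≤ ∑ ζ ∈ C, ‖φ ζ‖ ^ 2 := by
    intro φ hφ
    obtain ⟨M, hM0, hM, hM'⟩ := exists_sup_norm (continuous_of_mem_harmonicsUpTo hφ) ξ hr
    refine ⟨M, hM0, hM, ?_⟩
    rcases hM0.eq_or_lt with rfl | h0
    · rw [zero_pow two_ne_zero]; positivity
    · exact H ξ r hr hrpi C hC φ hφ M h0 hM (hM' h0)
  have ha : ∀ φ ∈ harmonicsUpTo d L, ((surfaceMeasure d).real (cap ξ r))⁻¹ *
      ∫ x in cap ξ r, ‖φ x‖ ^ 2 ∂(surfaceMeasure d) ≤ ∑ ζ ∈ C, ‖φ ζ‖ ^ 2 := by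
    intro φ hφ
    obtain ⟨M, -, hM, hle⟩ := hsup φ hφ
    exact (average_le_sq hr hM).trans hle
  have hb : IsUnisolvent C (harmonicsUpTo d L) := by
    intro φ hφ h0
    obtain ⟨M, -, hM, hle⟩ := hsup φ hφ
    rw [Finset.sum_eq_zero fun ζ hζ => by rw [h0 ζ hζ]; simp] at hle
    have hM0 : M = 0 := by nlinarith
    exact eq_zero_of_cap hd hφ hr fun x hx => norm_le_zero_iff.1 (hM0 ▸ hM x hx)
  refine ⟨ha, hb, fun n b => ?_⟩
  have hmem : ∀ c : Fin n → ℂ, ∑ j, c j • (b j : Sph d → ℂ) ∈ harmonicsUpTo d L := fun c =>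
    Submodule.sum_mem _ fun j _ => Submodule.smul_mem _ _ (b j).2
  have hzero : ∀ c : Fin n → ℂ, ∑ j, c j • (b j : Sph d → ℂ) = 0 → c = 0 := by
    intro c hc
    have : ∑ j, c j • b j = 0 := Subtype.ext (by simpa using hc)
    exact funext (Fintype.linearIndependent_iff.1 b.linearIndependent c this)
  have hcont : ∀ j, Continuous (b j : Sph d → ℂ) := fun j =>
    continuous_of_mem_harmonicsUpTo (b j).2
  have hP := star_dotProduct_gramPoints C (fun j => (b j : Sph d → ℂ))
  have hR := star_dotProduct_gramRegion (cap ξ r) hcont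
  have hUP : IsUnit (gramPoints C (fun j => (b j : Sph d → ℂ))) := by
    refine isUnit_of_quadratic_form fun c hc => hzero c (hb _ (hmem c) fun ζ hζ => ?_)
    rw [hP, Complex.ofReal_eq_zero,
      Finset.sum_eq_zero_iff_of_nonneg fun _ _ => by positivity] at hc
    simpa using hc ζ hζ
  have hUR : IsUnit (gramRegion (cap ξ r) (fun j => (b j : Sph d → ℂ))) := by
    refine isUnit_of_quadratic_form fun c hc => hzero c (eq_zero_of_cap (ξ := ξ) hd (hmem c) hr ?_)
    rw [hR, Complex.ofReal_eq_zero] at hc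
    exact eq_zero_of_setIntegral_eq_zero (continuous_of_mem_harmonicsUpTo (hmem c)) hc
  refine ⟨hUP, hUR, matNorm2_inv_le hμ hUR hUP (isHermitian_gramRegion _ _) (fun c => ?_)
    fun c => ?_⟩
  · rw [hR, Complex.ofReal_re]
    positivity
  · rw [hR, hP, Complex.ofReal_re, Complex.ofReal_re, ← inv_mul_le_iff₀ hμ]
    exact ha _ (hmem c)
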